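/- All graphs are finite and simple. A planar triangulation is a graph with a crossing-free drawing in the plane all of whose faces (including the outer face) are bounded by triangles. An oriented graph is a directed graph without directed cycles of length $1$ or $2$; connectedness, independence, and being a planar triangulation refer to its underlying undirected graph. An undirected graph is Eulerian if it is connected and every vertex has even degree; an oriented graph is Eulerian if it is connected and every vertex has equal in-degree and out-degree. A set of vertices is acyclic if it induces a forest (in an undirected graph), respectively if it induces a subdigraph without directed cycles (in an oriented graph). A CAI-partition of an undirected or oriented graph is a partition $(\mathcal{A},\mathcal{I})$ of its vertex set such that $\mathcal{A}$ is acyclic and induces a connected subgraph, and $\mathcal{I}$ is independent. Let $G$ be an Eulerian undirected planar triangulation, or an Eulerian oriented planar triangulation, and let $I_1,I_2,I_3$ be its tripartition, i.e. a partition of its vertex set into three independent sets. If for some $1\le i\le 3$ the graph $G-I_i$ has a CAI-partition $(\mathcal{A},\mathcal{I})$, then $A_1=\mathcal{A}$ and $A_2=\mathcal{I}\cup I_i$ form a partition of the vertex set of $G$ into two acyclic sets. Moreover, $A_1$ induces a connected subgraph of $G$, and $A_2$, which contains $I_i$, induces a forest in (the underlying undirected graph of) $G$. -/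

import Mathlib

namespace CAIGraph

/-! ### Plane drawings -/

/-- The Euclidean plane. -/
abbrev Plane := EuclideanSpace ℝ (Fin 2)

/-- `S` is a (simple) polygonal arc from `p` to `q`: there are points `x 0 = p, x 1, …, x n = q`
(with `1 ≤ n`) such that `S` is the union of the nondegenerate segments `[x i, x (i+1)]`, `i < n`,
two consecutive segments meet exactly in their common end, and any other two are disjoint. -/
def IsPolygonalArc (S : Set Plane) (p q : Plane) : Prop :=
  ∃ (n : ℕ) (x : ℕ → Plane), 0 < n ∧ x 0 = p ∧ x n = q ∧
    S = ⋃ i ∈ Set.Iio n, segment ℝ (x i) (x (i + 1)) ∧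
    (∀ i, i < n → x i ≠ x (i + 1)) ∧
    (∀ i, i + 1 < n →
      segment ℝ (x i) (x (i + 1)) ∩ segment ℝ (x (i + 1)) (x (i + 2)) = {x (i + 1)}) ∧
    (∀ i j, i + 1 < j → j < n →
      Disjoint (segment ℝ (x i) (x (i + 1))) (segment ℝ (x j) (x (j + 1))))

/-- A drawing of the graph `G` in the plane without crossings: vertices are distinct points, every
edge is a polygonal arc between its two ends that contains no other vertex, and two distinct edges
meet at most in common ends. (The value of `arc` at pairs that are not edges is irrelevant.) -/
structure PlaneDrawing {V : Type*} (G : SimpleGraph V) where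
  pos : V → Plane
  arc : Sym2 V → Set Plane
  pos_injective : Function.Injective pos
  isPolygonalArc : ∀ u v, G.Adj u v → IsPolygonalArc (arc s(u, v)) (pos u) (pos v)
  mem_of_pos_mem_arc : ∀ e ∈ G.edgeSet, ∀ w, pos w ∈ arc e → w ∈ e
  arc_inter_arc : ∀ e ∈ G.edgeSet, ∀ f ∈ G.edgeSet, e ≠ f →
    ∀ p ∈ arc e ∩ arc f, ∃ w, w ∈ e ∧ w ∈ f ∧ p = pos w

/-- The subset of the plane covered by the drawing. -/
def PlaneDrawing.support {V : Type*} {G : SimpleGraph V} (D : PlaneDrawing G) : Set Plane :=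
  Set.range D.pos ∪ ⋃ e ∈ G.edgeSet, D.arc e

/-- The faces of the drawing: the connected components of the complement of the drawing. -/
def PlaneDrawing.faces {V : Type*} {G : SimpleGraph V} (D : PlaneDrawing G) : Set (Set Plane) :=
  {F | ∃ x ∈ D.supportᶜ, F = connectedComponentIn D.supportᶜ x}

/-- A planar triangulation: a (simple) graph that has a drawing in the plane all of whose faces
(the outer face included) are bounded by triangles of the graph. -/
def IsPlanarTriangulation {V : Type*} (G : SimpleGraph V) : Prop :=
  ∃ D : PlaneDrawing G, ∀ F ∈ D.faces, ∃ a b c : V, G.Adj a b ∧ G.Adj b c ∧ G.Adj a c ∧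
    frontier F = D.arc s(a, b) ∪ D.arc s(b, c) ∪ D.arc s(a, c)

/-! ### Undirected graphs -/

/-- A graph is Eulerian if it is connected and all its vertices have even degree. -/
def IsEulerian {V : Type*} (G : SimpleGraph V) : Prop :=
  G.Connected ∧ ∀ v, Even (G.neighborSet v).ncard

/-- A tripartition: a partition of the vertex set into three independent sets. -/
structure IsTripartition {V : Type*} (G : SimpleGraph V) (P : Fin 3 → Set V) : Prop where
  disjoint : ∀ i j, i ≠ j → Disjoint (P i) (P j)
  cover : ⋃ i, P i = Set.univ
  indep : ∀ i, G.IsIndepSet (P i)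

/-- `S` induces a connected subgraph. -/
def IsConnectedSet {V : Type*} (G : SimpleGraph V) (S : Set V) : Prop :=
  (G.induce S).Connected

/-- `S` induces a forest. -/
def IsForestSet {V : Type*} (G : SimpleGraph V) (S : Set V) : Prop :=
  (G.induce S).IsAcyclic

/-- `(A, J)` is a CAI-partition of the graph `G`: the sets `A` and `J` partition the vertex set,
`A` induces a tree (a connected forest), and `J` is independent. -/
structure IsCAIPartition {V : Type*} (G : SimpleGraph V) (A J : Set V) : Prop where
  isCompl : IsCompl A J
  connected : IsConnectedSet G A
  acyclic : IsForestSet G A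
  indep : G.IsIndepSet J

/-! ### Oriented graphs -/

/-- An oriented graph: a directed graph without directed cycles of length `1` or `2`. -/
def IsOriented {V : Type*} (D : Digraph V) : Prop :=
  (∀ u, ¬ D.Adj u u) ∧ ∀ u v, D.Adj u v → ¬ D.Adj v u

/-- The underlying undirected graph: distinct vertices are adjacent if there is an arc between
them in at least one direction. -/
abbrev underlying {V : Type*} (D : Digraph V) : SimpleGraph V :=
  D.toSimpleGraphInclusive

/-- The subdigraph induced by a set of vertices. -/
def induceDigraph {V : Type*} (D : Digraph V) (S : Set V) : Digraph S where
  Adj u v := D.Adj u v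

/-- There is a directed cycle `c 0 → c 1 → ⋯ → c n → c 0` with distinct vertices. (The addition in
`Fin (n + 1)` is cyclic.) -/
def HasDirectedCycle {V : Type*} (D : Digraph V) : Prop :=
  ∃ (n : ℕ) (c : Fin (n + 1) → V), Function.Injective c ∧ ∀ i, D.Adj (c i) (c (i + 1))

/-- `S` is acyclic in the digraph: it induces a subdigraph without directed cycles. -/
def IsDiacyclicSet {V : Type*} (D : Digraph V) (S : Set V) : Prop :=
  ¬ HasDirectedCycle (induceDigraph D S)

/-- An oriented graph is Eulerian if it is connected and every vertex has out-degree equal to its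
in-degree. -/
def IsEulerianDigraph {V : Type*} (D : Digraph V) : Prop :=
  (underlying D).Connected ∧ ∀ v, {w | D.Adj v w}.ncard = {w | D.Adj w v}.ncard

/-- `(A, J)` is a CAI-partition of the oriented graph `D`: the sets `A` and `J` partition the
vertex set, `A` induces a connected subdigraph without directed cycles, and `J` is independent. -/
structure IsCAIDipartition {V : Type*} (D : Digraph V) (A J : Set V) : Prop where
  isCompl : IsCompl A J
  connected : IsConnectedSet (underlying D) A
  acyclic : IsDiacyclicSet D A
  indep : (underlying D).IsIndepSet J

end CAIGraph

open CAIGraph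

/-! Put `S = J ∪ I`, with `I` the removed class. As a union of two independent sets, `S` contains no
triangle, so every face of the triangulation has a boundary vertex outside `S`, that is, in the
connected set `A`. A cycle inside `S` would separate the plane, with a face on either side and hence
vertices of `A` on both sides; but a walk in `A` between them is drawn disjointly from the cycle. So
`S` induces a forest (`isForestSet_of_compl_preconnected`), and in an oriented graph a forest has no
directed cycle.

Only the separating half of the Jordan curve theorem is needed, and it comes from a winding number.
Off a segment `[a, b]` the principal logarithm of `(b - z) / (a - z)` is continuous. Summed around a
closed walk these quotients telescope to `1`, so the sum of logarithms takes values in `2πiℤ` and is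
constant on connected sets missing the walk (`IsArcLog.eq_of_isPreconnected`). Across the midpoint
of one segment it jumps (`segmentLog_jump`), so it takes two values. -/

namespace CAIGraph

open Set Filter Topology

/-! ### The argument along a polygonal arc -/

/-- The isometry between the Euclidean plane and the complex plane. -/
noncomputable def toComplex : Plane ≃ₗᵢ[ℝ] ℂ := Complex.orthonormalBasisOneI.repr.symm

/-- If the quotient is `-k` with `k ≥ 0`, then `z = (k a + b) / (1 + k)`, a convex combination. -/
theorem div_mem_slitPlane_of_notMem_segment {a b z : ℂ} (hz : z ∉ segment ℝ a b) :
    (b - z) / (a - z) ∈ Complex.slitPlane := by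
  by_contra h
  have haz : a - z ≠ 0 := by
    intro h0
    rw [sub_eq_zero] at h0
    exact hz (h0 ▸ left_mem_segment ℝ a b)
  rw [Complex.mem_slitPlane_iff, not_or, not_lt, not_not] at h
  obtain ⟨hre, him⟩ := h
  obtain ⟨k, hk⟩ : ∃ k : ℝ, k = -((b - z) / (a - z)).re := ⟨_, rfl⟩
  have hk0 : 0 ≤ k := by linarith
  have hq : (b - z) / (a - z) = -(k : ℂ) := by
    apply Complex.ext <;> simp [hk, him]
  rw [div_eq_iff haz] at hq
  have hk1 : (1 + k : ℂ) ≠ 0 := by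
    have : (1 + k : ℝ) ≠ 0 := by positivity
    exact_mod_cast this
  refine hz ⟨k / (1 + k), 1 / (1 + k), by positivity, by positivity, by field_simp; ring, ?_⟩
  simp only [Complex.real_smul]
  push_cast
  field_simp
  linear_combination hq

theorem div_notMem_slitPlane_of_mem_segment {a b z : ℂ} (hz : z ∈ segment ℝ a b) :
    (b - z) / (a - z) ∉ Complex.slitPlane := by
  obtain ⟨s, t, hs, ht, hst, rfl⟩ := hz
  simp only [Complex.real_smul]
  obtain rfl : s = 1 - t := by linarith
  rw [show b - (((1 - t : ℝ) : ℂ) * a + t * b) = ((1 - t : ℝ) : ℂ) * (b - a) by push_cast; ring,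
    show a - (((1 - t : ℝ) : ℂ) * a + t * b) = ((-t : ℝ) : ℂ) * (b - a) by push_cast; ring]
  by_cases hab : b - a = 0
  · simp [hab]
  rw [mul_div_mul_right _ _ hab, ← Complex.ofReal_div, Complex.ofReal_mem_slitPlane, not_lt]
  exact div_nonpos_of_nonneg_of_nonpos hs (by linarith)

/-- The logarithm of `(b - z) / (a - z)`: its imaginary part is the angle under which the segment
`[a, b]` is seen from `z`. -/
noncomputable def segmentLog (a b z : Plane) : ℂ :=
  Complex.log ((toComplex b - toComplex z) / (toComplex a - toComplex z))

theorem toComplex_mem_segment {a b z : Plane} :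
    toComplex z ∈ segment ℝ (toComplex a) (toComplex b) ↔ z ∈ segment ℝ a b := by
  have h := image_segment ℝ (toComplex.toLinearEquiv : Plane →ₗ[ℝ] ℂ).toAffineMap a b
  have h2 : toComplex '' segment ℝ a b = segment ℝ (toComplex a) (toComplex b) := h
  rw [← h2, toComplex.injective.mem_set_image]

theorem isClosed_segment (a b : Plane) : IsClosed (segment ℝ a b) := by
  rw [← convexHull_pair]
  exact ((Set.toFinite {a, b}).isCompact_convexHull (𝕜 := ℝ)).isClosed

theorem continuousAt_segmentLog {a b z : Plane} (hz : z ∉ segment ℝ a b) :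
    ContinuousAt (segmentLog a b) z := by
  have hza : toComplex a - toComplex z ≠ 0 := by
    rw [sub_ne_zero]
    intro h
    exact hz (toComplex.injective h ▸ left_mem_segment ℝ a b)
  refine ContinuousAt.clog ?_
    (div_mem_slitPlane_of_notMem_segment (mt toComplex_mem_segment.1 hz))
  exact (continuousAt_const.sub toComplex.continuous.continuousAt).div
    (continuousAt_const.sub toComplex.continuous.continuousAt) hza

theorem exp_segmentLog {a b z : Plane} (hz : z ∉ segment ℝ a b) :
    Complex.exp (segmentLog a b z) =
      (toComplex b - toComplex z) / (toComplex a - toComplex z) :=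
  Complex.exp_log (Complex.slitPlane_ne_zero
    (div_mem_slitPlane_of_notMem_segment (mt toComplex_mem_segment.1 hz)))

/-- The points of the perpendicular bisector of `[a, b]`. -/
noncomputable def bisector (a b : Plane) (t : ℝ) : Plane :=
  toComplex.symm
    ((toComplex a + toComplex b) / 2 + t * Complex.I * (toComplex b - toComplex a))

theorem continuous_bisector (a b : Plane) : Continuous (bisector a b) := by
  unfold bisector
  fun_prop

theorem bisector_zero_mem (a b : Plane) : bisector a b 0 ∈ segment ℝ a b := by
  rw [← toComplex_mem_segment]
  refine ⟨1 / 2, 1 / 2, by norm_num, by norm_num, by norm_num, ?_⟩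
  simp [bisector]
  ring

theorem bisector_zero_ne_left {a b : Plane} (h : a ≠ b) : bisector a b 0 ≠ a := by
  intro h0
  have := congrArg toComplex h0
  simp only [bisector, LinearIsometryEquiv.apply_symm_apply] at this
  refine h (toComplex.injective ?_)
  simp at this
  linear_combination (-2) * this

theorem bisector_zero_ne_right {a b : Plane} (h : a ≠ b) : bisector a b 0 ≠ b := by
  intro h0
  have := congrArg toComplex h0
  simp only [bisector, LinearIsometryEquiv.apply_symm_apply] at this
  refine h (toComplex.injective ?_)
  simp at this
  linear_combination 2 * this

/-- The explicit value shows that `t ↦ -t` conjugates the quotient, and that its real part is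
negative for `|t| < 1 / 2`. -/
theorem bisector_quotient {a b : Plane} (h : a ≠ b) (t : ℝ) :
    (toComplex b - toComplex (bisector a b t)) / (toComplex a - toComplex (bisector a b t)) =
      (⟨-(1 - 4 * t ^ 2) / (1 + 4 * t ^ 2), 4 * t / (1 + 4 * t ^ 2)⟩ : ℂ) := by
  have hab : toComplex b - toComplex a ≠ 0 := by
    rw [sub_ne_zero]
    exact fun h' => h (toComplex.injective h').symm
  have h1 : toComplex b - toComplex (bisector a b t) =
      (1 / 2 - t * Complex.I) * (toComplex b - toComplex a) := by
    simp only [bisector, LinearIsometryEquiv.apply_symm_apply]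
    ring
  have h2 : toComplex a - toComplex (bisector a b t) =
      (-1 / 2 - t * Complex.I) * (toComplex b - toComplex a) := by
    simp only [bisector, LinearIsometryEquiv.apply_symm_apply]
    ring
  rw [h1, h2, mul_div_mul_right _ _ hab]
  have h3 : (-1 / 2 - t * Complex.I : ℂ) ≠ 0 := by
    intro h0
    have := congrArg Complex.re h0
    norm_num at this
  rw [div_eq_iff h3]
  have h4 : (1 + 4 * t ^ 2 : ℝ) ≠ 0 := by positivity
  apply Complex.ext
  · simp
    field_simp
    ring
  · simp
    field_simp
    ring

theorem bisector_notMem {a b : Plane} (h : a ≠ b) {t : ℝ} (ht : t ≠ 0) :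
    bisector a b t ∉ segment ℝ a b := by
  intro hmem
  refine div_notMem_slitPlane_of_mem_segment (toComplex_mem_segment.2 hmem) ?_
  rw [bisector_quotient h, Complex.mem_slitPlane_iff]
  right
  have h4 : (1 + 4 * t ^ 2 : ℝ) ≠ 0 := by positivity
  simp [ht, h4]

theorem segmentLog_jump {a b : Plane} (h : a ≠ b) {t : ℝ} (ht : 0 < t) (ht' : t < 1 / 2) :
    3 < ‖segmentLog a b (bisector a b t) - segmentLog a b (bisector a b (-t))‖ := by
  -- Conjugate points with negative real part have opposite arguments of modulus above `π / 2`, so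
  -- their logarithms differ by more than `π > 3`.
  have hw : ∀ w : ℂ, w.re < 0 → w.im ≠ 0 → 3 < ‖Complex.log w - Complex.log (star w)‖ := by
    intro w hre him
    have harg : w.arg ≠ Real.pi := fun h => him (Complex.arg_eq_pi_iff.1 h).2
    have hl : Complex.log (star w) = star (Complex.log w) := Complex.log_conj w harg
    have h1 := mt Complex.abs_arg_le_pi_div_two_iff.1 (not_le.2 hre)
    have h2 : Complex.log w - star (Complex.log w) = ((2 * w.arg : ℝ) : ℂ) * Complex.I := by
      apply Complex.ext <;> simp [Complex.log_im]
      ring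
    rw [hl, h2, norm_mul, Complex.norm_I, mul_one, Complex.norm_real, Real.norm_eq_abs, abs_mul,
      abs_two]
    linarith [Real.pi_gt_three, not_le.1 h1]
  unfold segmentLog
  rw [bisector_quotient h, bisector_quotient h]
  have h4 : (0 : ℝ) < 1 + 4 * t ^ 2 := by positivity
  convert hw _ ?_ ?_ using 4
  · apply Complex.ext <;> simp
    ring
  · apply div_neg_of_neg_of_pos _ h4
    nlinarith
  · simp [ht.ne', h4.ne']

/-! ### Polygonal arcs -/

theorem IsPolygonalArc.isClosed {S : Set Plane} {p q : Plane} (h : IsPolygonalArc S p q) :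
    IsClosed S := by
  obtain ⟨n, x, -, -, -, rfl, -⟩ := h
  exact (Set.finite_Iio n).isClosed_biUnion fun i _ => isClosed_segment _ _

theorem IsPolygonalArc.left_mem {S : Set Plane} {p q : Plane} (h : IsPolygonalArc S p q) :
    p ∈ S := by
  obtain ⟨n, x, hn, rfl, -, rfl, -⟩ := h
  exact mem_biUnion (mem_Iio.2 hn) (left_mem_segment ℝ _ _)

theorem IsPolygonalArc.right_mem {S : Set Plane} {p q : Plane} (h : IsPolygonalArc S p q) :
    q ∈ S := by
  obtain ⟨n, x, hn, -, rfl, rfl, -⟩ := h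
  obtain ⟨m, rfl⟩ : ∃ m, n = m + 1 := ⟨n - 1, by omega⟩
  exact mem_biUnion (mem_Iio.2 (Nat.lt_succ_self m)) (right_mem_segment ℝ _ _)

theorem isPreconnected_biUnion_segment (x : ℕ → Plane) (n : ℕ) :
    IsPreconnected (⋃ i ∈ Iio n, segment ℝ (x i) (x (i + 1))) := by
  refine IsPreconnected.biUnion_of_chain ordConnected_Iio
    (fun i _ => (convex_segment _ _).isPreconnected) fun i _ _ => ⟨x (i + 1), ?_, ?_⟩
  · exact right_mem_segment ℝ _ _
  · exact left_mem_segment ℝ _ _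

theorem IsPolygonalArc.isPreconnected {S : Set Plane} {p q : Plane} (h : IsPolygonalArc S p q) :
    IsPreconnected S := by
  obtain ⟨n, x, -, -, -, rfl, -⟩ := h
  exact isPreconnected_biUnion_segment x n

theorem volume_segment (a b : Plane) : MeasureTheory.volume (segment ℝ a b) = 0 := by
  have hsub : segment ℝ a b ⊆ (affineSpan ℝ {a, b} : AffineSubspace ℝ Plane) := by
    rw [← convexHull_pair]
    exact convexHull_subset_affineSpan _
  refine MeasureTheory.measure_mono_null hsub (MeasureTheory.Measure.addHaar_affineSubspace _ _ ?_)
  intro htop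
  have h1 : Module.finrank ℝ (vectorSpan ℝ {a, b}) ≤ 1 :=
    collinear_iff_finrank_le_one.1 (collinear_pair ℝ a b)
  rw [← direction_affineSpan, htop, AffineSubspace.direction_top, finrank_top,
    finrank_euclideanSpace_fin] at h1
  omega

theorem IsPolygonalArc.volume_eq_zero {S : Set Plane} {p q : Plane} (h : IsPolygonalArc S p q) :
    MeasureTheory.volume S = 0 := by
  obtain ⟨n, x, -, -, -, rfl, -⟩ := h
  rw [MeasureTheory.measure_biUnion_null_iff (Set.finite_Iio n).countable]
  exact fun i _ => volume_segment _ _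

/-- The logarithm of `(q - z) / (p - z)`, chosen continuously off an arc from `p` to `q`. -/
structure IsArcLog (S : Set Plane) (p q : Plane) (L : Plane → ℂ) : Prop where
  continuousAt : ∀ z ∉ S, ContinuousAt L z
  exp_eq : ∀ z ∉ S, z ≠ p →
    Complex.exp (L z) = (toComplex q - toComplex z) / (toComplex p - toComplex z)

/-- Base case for chains and walks. At `z = p` the quotient is `0 / 0 = 0`, never a value of `exp`;
hence the proviso `z ≠ p` in `exp_eq`. -/
theorem IsArcLog.zero (p : Plane) : IsArcLog ∅ p p 0 where
  continuousAt _ _ := continuousAt_const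
  exp_eq z _ hz := by
    rw [Pi.zero_apply, Complex.exp_zero, div_self]
    rw [sub_ne_zero]
    exact fun h => hz (toComplex.injective h).symm

theorem IsArcLog.segmentLog (a b : Plane) : IsArcLog (segment ℝ a b) a b (segmentLog a b) where
  continuousAt _ := continuousAt_segmentLog
  exp_eq _ hz _ := exp_segmentLog hz

/-- The quotients telescope; `hq` ensures `z ≠ q`, so that the factor `q - z` cancels. -/
theorem IsArcLog.add {S T : Set Plane} {p q r : Plane} {L M : Plane → ℂ} (hL : IsArcLog S p q L)
    (hM : IsArcLog T q r M) (hq : q ∈ S ∪ T ∨ q = p) : IsArcLog (S ∪ T) p r (L + M) where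
  continuousAt z hz :=
    (hL.continuousAt z fun h => hz (Or.inl h)).add (hM.continuousAt z fun h => hz (Or.inr h))
  exp_eq z hz hp := by
    have hzq : z ≠ q := by
      rintro rfl
      exact hq.elim hz hp
    have hq0 : toComplex q - toComplex z ≠ 0 := by
      rw [sub_ne_zero]
      exact fun h => hzq (toComplex.injective h).symm
    rw [Pi.add_apply, Complex.exp_add, hL.exp_eq z (fun h => hz (Or.inl h)) hp,
      hM.exp_eq z (fun h => hz (Or.inr h)) hzq, mul_comm, div_mul_div_cancel₀ hq0]

theorem exists_isArcLog_chain (x : ℕ → Plane) (n : ℕ) :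
    ∃ L, IsArcLog (⋃ i ∈ Iio n, segment ℝ (x i) (x (i + 1))) (x 0) (x n) L := by
  induction n with
  | zero => exact ⟨0, by simpa using IsArcLog.zero (x 0)⟩
  | succ n ih =>
    obtain ⟨L, hL⟩ := ih
    refine ⟨L + segmentLog (x n) (x (n + 1)), ?_⟩
    have h : (⋃ i ∈ Iio (n + 1), segment ℝ (x i) (x (i + 1))) =
        (⋃ i ∈ Iio n, segment ℝ (x i) (x (i + 1))) ∪ segment ℝ (x n) (x (n + 1)) := by
      rw [← Order.succ_eq_add_one n, Order.Iio_succ_eq_insert, biUnion_insert, union_comm]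
      rfl
    rw [h]
    exact hL.add (IsArcLog.segmentLog _ _) (Or.inl (Or.inr (left_mem_segment ℝ _ _)))

theorem IsPolygonalArc.exists_isArcLog {S : Set Plane} {p q : Plane} (h : IsPolygonalArc S p q) :
    ∃ L, IsArcLog S p q L := by
  obtain ⟨n, x, -, rfl, rfl, rfl, -⟩ := h
  exact exists_isArcLog_chain x n

/-- Across a polygonal arc the argument jumps. -/
theorem IsPolygonalArc.exists_jump {S : Set Plane} {p q : Plane} (h : IsPolygonalArc S p q) :
    ∃ L, IsArcLog S p q L ∧ ∃ m ∈ S, m ≠ p ∧ m ≠ q ∧ ∃ f g : ℝ → Plane,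
      Tendsto f (𝓝[>] 0) (𝓝 m) ∧ Tendsto g (𝓝[>] 0) (𝓝 m) ∧
      ∀ᶠ t in 𝓝[>] 0, f t ∉ S ∧ g t ∉ S ∧ 2 < ‖L (f t) - L (g t)‖ := by
  obtain ⟨n, x, hn, rfl, rfl, hS, hne, hcons, hdisj⟩ := h
  obtain ⟨k, rfl⟩ : ∃ k, n = k + 1 := ⟨n - 1, by omega⟩
  obtain ⟨M, hM⟩ := exists_isArcLog_chain (fun i => x (i + 1)) k
  set T := ⋃ i ∈ Iio k, segment ℝ (x (i + 1)) (x (i + 1 + 1)) with hT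
  have hST : S = segment ℝ (x 0) (x 1) ∪ T := by
    rw [hS]
    ext z
    simp only [mem_iUnion, mem_Iio, exists_prop, mem_union, hT]
    constructor
    · rintro ⟨i, hi, hz⟩
      cases i with
      | zero => exact Or.inl hz
      | succ i => exact Or.inr ⟨i, by omega, hz⟩
    · rintro (hz | ⟨i, hi, hz⟩)
      · exact ⟨0, by omega, hz⟩
      · exact ⟨i + 1, by omega, hz⟩
  have h01 : x 0 ≠ x 1 := hne 0 hn
  obtain ⟨m, hm⟩ : ∃ m, m = bisector (x 0) (x 1) 0 := ⟨_, rfl⟩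
  have hm0 : m ∈ segment ℝ (x 0) (x 1) := hm ▸ bisector_zero_mem _ _
  have hmT : m ∉ T := by
    simp only [hT, mem_iUnion, mem_Iio, exists_prop, not_exists, not_and]
    intro i hi hz
    cases i with
    | zero =>
      have h1 : m ∈ ({x 1} : Set Plane) := hcons 0 (by omega) ▸ ⟨hm0, hz⟩
      exact bisector_zero_ne_right h01 (hm ▸ h1)
    | succ i =>
      exact (hdisj 0 (i + 1 + 1) (by omega) (by omega)).le_bot ⟨hm0, hz⟩
  have hmq : m ≠ x (k + 1) := by
    rintro rfl
    cases k with
    | zero => exact bisector_zero_ne_right h01 hm.symm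
    | succ k =>
      exact hmT (mem_biUnion (mem_Iio.2 (Nat.lt_succ_self k)) (right_mem_segment ℝ _ _))
  have hTc : IsClosed T := (Set.finite_Iio k).isClosed_biUnion fun i _ => isClosed_segment _ _
  have hf : Tendsto (bisector (x 0) (x 1)) (𝓝[>] 0) (𝓝 m) := by
    rw [hm]
    exact (continuous_bisector _ _).continuousAt.mono_left nhdsWithin_le_nhds
  have hg : Tendsto (fun t => bisector (x 0) (x 1) (-t)) (𝓝[>] 0) (𝓝 m) := by
    have h : Continuous fun t : ℝ => bisector (x 0) (x 1) (-t) :=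
      (continuous_bisector _ _).comp continuous_neg
    have h0 := h.continuousAt (x := (0 : ℝ))
    simp only [ContinuousAt, neg_zero, ← hm] at h0
    exact h0.mono_left nhdsWithin_le_nhds
  refine ⟨segmentLog (x 0) (x 1) + M, ?_, m, hST ▸ Or.inl hm0,
    hm ▸ bisector_zero_ne_left h01, hmq, _, _, hf, hg, ?_⟩
  · rw [hST]
    exact (IsArcLog.segmentLog _ _).add hM (Or.inl (Or.inl (right_mem_segment ℝ _ _)))
  · have hMc := hM.continuousAt m hmT
    -- The other segments miss `m`, so `M` is continuous there and its difference across `m` drops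
    -- below `1`. Of the jump `3` more than `2` survives, a margin used again for the other edges of
    -- a cycle.
    have hdist := ((hMc.tendsto.comp hf).sub (hMc.tendsto.comp hg)).norm
    rw [sub_self, norm_zero] at hdist
    filter_upwards [hdist.eventually_lt_const one_pos,
      hf.eventually_mem (hTc.isOpen_compl.mem_nhds hmT),
      hg.eventually_mem (hTc.isOpen_compl.mem_nhds hmT),
      Ioo_mem_nhdsGT (show (0 : ℝ) < 1 / 2 by norm_num)] with t h1 h2 h3 ht
    refine ⟨?_, ?_, ?_⟩
    · rw [hST, mem_union, not_or]
      exact ⟨bisector_notMem h01 ht.1.ne', h2⟩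
    · rw [hST, mem_union, not_or]
      exact ⟨bisector_notMem h01 (neg_ne_zero.2 ht.1.ne'), h3⟩
    · have hj := segmentLog_jump h01 ht.1 ht.2
      have htri := norm_sub_le
        ((segmentLog (x 0) (x 1) + M) (bisector (x 0) (x 1) t) -
          (segmentLog (x 0) (x 1) + M) (bisector (x 0) (x 1) (-t)))
        (M (bisector (x 0) (x 1) t) - M (bisector (x 0) (x 1) (-t)))
      rw [show (segmentLog (x 0) (x 1) + M) (bisector (x 0) (x 1) t) -
          (segmentLog (x 0) (x 1) + M) (bisector (x 0) (x 1) (-t)) -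
          (M (bisector (x 0) (x 1) t) - M (bisector (x 0) (x 1) (-t))) =
          segmentLog (x 0) (x 1) (bisector (x 0) (x 1) t) -
          segmentLog (x 0) (x 1) (bisector (x 0) (x 1) (-t)) by
        simp only [Pi.add_apply]; ring] at htri
      simp only [Function.comp_apply] at h1
      linarith

/-! ### Cycles of a plane graph separate the plane -/

/-- For equal ends `exp (L z) = 1`, so `L / (2πi)` is continuous and integer-valued off `K`: a
winding number. -/
theorem IsArcLog.eq_of_isPreconnected {K : Set Plane} {p : Plane} {L : Plane → ℂ}
    (hL : IsArcLog K p p L) (hp : p ∈ K) {U : Set Plane} (hU : IsPreconnected U)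
    (hUK : Disjoint U K) {y z : Plane} (hy : y ∈ U) (hz : z ∈ U) : L y = L z := by
  have hK : ∀ z ∈ U, z ∉ K := fun z h => hUK.notMem_of_mem_left h
  have hint : ∀ z ∈ U, ∃ n : ℤ, L z = n * (2 * Real.pi * Complex.I) := by
    intro z h
    have hzp : z ≠ p := fun h' => hK z h (h' ▸ hp)
    rw [← Complex.exp_eq_one_iff, hL.exp_eq z (hK z h) hzp, div_self]
    rw [sub_ne_zero]
    exact fun h' => hzp (toComplex.injective h').symm
  have hpi : (2 * Real.pi * Complex.I : ℂ) ≠ 0 := Complex.two_pi_I_ne_zero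
  have hdisc : DiscreteTopology (range ((↑) : ℤ → ℝ)) :=
    (Int.isClosedEmbedding_coe_real.isEmbedding.toHomeomorph).symm.isEmbedding.discreteTopology
  have hcont : ContinuousOn (fun z => (L z / (2 * Real.pi * Complex.I)).re) U := fun z h =>
    (Complex.continuous_re.continuousAt.comp
      ((hL.continuousAt z (hK z h)).div_const _)).continuousWithinAt
  obtain ⟨c, -, hc⟩ := hU.eqOn_const_of_mapsTo (T := range ((↑) : ℤ → ℝ)) ⟨hdisc⟩ hcont
    (fun z h => by
      obtain ⟨n, hn⟩ := hint z h
      exact ⟨n, by simp only [hn, mul_div_cancel_right₀ _ hpi, Complex.intCast_re]⟩)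
    (range_nonempty _)
  have hval : ∀ z ∈ U, L z = c * (2 * Real.pi * Complex.I) := by
    intro z h
    obtain ⟨n, hn⟩ := hint z h
    have := hc h
    simp only [hn, mul_div_cancel_right₀ _ hpi, Complex.intCast_re, Function.const_apply] at this
    rw [hn, ← this, Complex.ofReal_intCast]
  rw [hval y hy, hval z hz]

namespace PlaneDrawing

variable {V : Type*} {G : SimpleGraph V} (D : PlaneDrawing G)

/-- The subset of the plane covered by the edges of a walk. -/
def walkArc {u v : V} (w : G.Walk u v) : Set Plane := ⋃ e ∈ {e | e ∈ w.edges}, D.arc e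

theorem mem_walkArc {u v : V} {w : G.Walk u v} {z : Plane} :
    z ∈ D.walkArc w ↔ ∃ e ∈ w.edges, z ∈ D.arc e := by
  simp [walkArc]

theorem walkArc_cons {u v w : V} (h : G.Adj u v) (p : G.Walk v w) :
    D.walkArc (.cons h p) = D.arc s(u, v) ∪ D.walkArc p := by
  ext z
  simp [mem_walkArc]

theorem isClosed_arc {e : Sym2 V} (he : e ∈ G.edgeSet) : IsClosed (D.arc e) := by
  induction e with
  | h u v => exact (D.isPolygonalArc u v he).isClosed

theorem isClosed_walkArc {u v : V} (w : G.Walk u v) : IsClosed (D.walkArc w) :=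
  (List.finite_toSet w.edges).isClosed_biUnion fun _ he =>
    D.isClosed_arc (w.edges_subset_edgeSet he)

theorem walkArc_subset_support {u v : V} (w : G.Walk u v) : D.walkArc w ⊆ D.support := by
  intro z hz
  obtain ⟨e, he, hz⟩ := D.mem_walkArc.1 hz
  exact Or.inr (mem_biUnion (w.edges_subset_edgeSet he) hz)

theorem pos_notMem_walkArc {u v a : V} {w : G.Walk u v} (ha : a ∉ w.support) :
    D.pos a ∉ D.walkArc w := by
  intro hz
  obtain ⟨e, he, hz⟩ := D.mem_walkArc.1 hz
  exact ha (w.mem_support_of_mem_edges he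
    (D.mem_of_pos_mem_arc e (w.edges_subset_edgeSet he) a hz))

theorem disjoint_arc_walkArc {u v a b : V} {w : G.Walk u v} (hab : G.Adj a b)
    (ha : a ∉ w.support) (hb : b ∉ w.support) : Disjoint (D.arc s(a, b)) (D.walkArc w) := by
  rw [Set.disjoint_left]
  intro z hz hzw
  obtain ⟨e, he, hze⟩ := D.mem_walkArc.1 hzw
  have hne : s(a, b) ≠ e := by
    rintro rfl
    exact ha (w.fst_mem_support_of_mem_edges he)
  obtain ⟨x, hx, hxe, -⟩ :=
    D.arc_inter_arc _ hab e (w.edges_subset_edgeSet he) hne z ⟨hz, hze⟩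
  have hxw := w.mem_support_of_mem_edges he hxe
  rcases Sym2.mem_iff.1 hx with rfl | rfl
  exacts [ha hxw, hb hxw]

theorem exists_isArcLog_walkArc {u v : V} (w : G.Walk u v) :
    ∃ L, IsArcLog (D.walkArc w) (D.pos u) (D.pos v) L := by
  induction w with
  | nil => exact ⟨0, by simpa [walkArc] using IsArcLog.zero (D.pos _)⟩
  | cons h p ih =>
    obtain ⟨M, hM⟩ := ih
    obtain ⟨L, hL⟩ := (D.isPolygonalArc _ _ h).exists_isArcLog
    rw [walkArc_cons]
    exact ⟨_, hL.add hM (Or.inl (Or.inl (D.isPolygonalArc _ _ h).right_mem))⟩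

theorem dense_compl_support [Finite V] : Dense D.supportᶜ := by
  refine MeasureTheory.Measure.dense_of_ae (μ := MeasureTheory.volume)
    (p := fun x => x ∉ D.support) ?_
  rw [← MeasureTheory.measure_eq_zero_iff_ae_notMem]
  refine MeasureTheory.measure_union_null ((finite_range D.pos).measure_zero _) ?_
  rw [MeasureTheory.measure_biUnion_null_iff (toFinite G.edgeSet).countable]
  intro e he
  induction e with
  | h u v => exact (D.isPolygonalArc u v he).volume_eq_zero

/-- A cycle separates two points that avoid the drawing. -/
theorem exists_separated [Finite V] {u v : V} (h : G.Adj u v) (p : G.Walk v u)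
    (hp : s(u, v) ∉ p.edges) :
    ∃ L, IsArcLog (D.walkArc (.cons h p)) (D.pos u) (D.pos u) L ∧
      ∃ y ∉ D.support, ∃ z ∉ D.support, L y ≠ L z := by
  obtain ⟨L, hL, m, hm, hmu, hmv, f, g, hf, hg, hfg⟩ := (D.isPolygonalArc u v h).exists_jump
  obtain ⟨M, hM⟩ := D.exists_isArcLog_walkArc p
  have hLM := hL.add hM (Or.inl (Or.inl (D.isPolygonalArc u v h).right_mem))
  rw [← walkArc_cons _ h] at hLM
  refine ⟨L + M, hLM, ?_⟩
  -- The edge `uv` is traversed only once, and `m` is not an end of it, so no other edge of the walk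
  -- passes through `m`.
  have hmp : m ∉ D.walkArc p := by
    intro hmp
    obtain ⟨e, he, hme⟩ := D.mem_walkArc.1 hmp
    obtain ⟨x, hx, -, rfl⟩ := D.arc_inter_arc _ h e (p.edges_subset_edgeSet he)
      (by rintro rfl; exact hp he) m ⟨hm, hme⟩
    rcases Sym2.mem_iff.1 hx with rfl | rfl
    exacts [hmu rfl, hmv rfl]
  have hMc := hM.continuousAt m hmp
  have hdist := ((hMc.tendsto.comp hf).sub (hMc.tendsto.comp hg)).norm
  rw [sub_self, norm_zero] at hdist
  have hmem := (D.isClosed_walkArc p).isOpen_compl.mem_nhds hmp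
  obtain ⟨t, ⟨⟨hft, hgt, h2⟩, h1⟩, hfp, hgp⟩ := ((hfg.and (hdist.eventually_lt_const one_pos)).and
    ((hf.eventually_mem hmem).and (hg.eventually_mem hmem))).exists
  have hne : (L + M) (f t) ≠ (L + M) (g t) := by
    intro heq
    have h3 : L (f t) - L (g t) = -(M (f t) - M (g t)) := by
      simp only [Pi.add_apply] at heq
      linear_combination heq
    rw [h3, norm_neg] at h2
    simp only [Function.comp_apply] at h1
    linarith
  -- The points `f t` and `g t` may lie on edges outside the cycle. Each is moved off the drawing
  -- within a ball that misses the cycle, where `L + M` is constant.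
  have key : ∀ x, x ∉ D.walkArc (.cons h p) → ∃ y ∉ D.support, (L + M) y = (L + M) x := by
    intro x hx
    obtain ⟨ε, hε, hball⟩ := Metric.isOpen_iff.1 (D.isClosed_walkArc (.cons h p)).isOpen_compl x hx
    obtain ⟨y, hy, hyb⟩ := D.dense_compl_support.exists_mem_open Metric.isOpen_ball
      ⟨x, Metric.mem_ball_self hε⟩
    refine ⟨y, hy, hLM.eq_of_isPreconnected ?_ (convex_ball x ε).isPreconnected
      (Set.disjoint_left.2 hball) hyb (Metric.mem_ball_self hε)⟩
    rw [walkArc_cons]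
    exact Or.inl (D.isPolygonalArc u v h).left_mem
  obtain ⟨y, hy, hyL⟩ := key (f t) (by rw [walkArc_cons]; exact fun h' => h'.elim hft hfp)
  obtain ⟨z, hz, hzL⟩ := key (g t) (by rw [walkArc_cons]; exact fun h' => h'.elim hgt hgp)
  exact ⟨y, hy, z, hz, by rwa [hyL, hzL]⟩

/-- In a plane graph all of whose faces are bounded by triangles, a triangle-free set of vertices
with connected complement induces a forest. -/
theorem isForestSet_of_compl_preconnected [Finite V]
    (hD : ∀ F ∈ D.faces, ∃ a b c : V, G.Adj a b ∧ G.Adj b c ∧ G.Adj a c ∧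
      frontier F = D.arc s(a, b) ∪ D.arc s(b, c) ∪ D.arc s(a, c))
    {S : Set V} (hS : ∀ a ∈ S, ∀ b ∈ S, ∀ c ∈ S, G.Adj a b → G.Adj b c → ¬ G.Adj a c)
    (hconn : (G.induce Sᶜ).Preconnected) : IsForestSet G S := by
  intro x c hc
  obtain ⟨c', hc'⟩ : ∃ c', c' = c.map (SimpleGraph.Embedding.induce S).toHom := ⟨_, rfl⟩
  have hcyc : c'.IsCycle := hc' ▸ hc.map Subtype.val_injective
  have hsupp : ∀ a ∈ c'.support, a ∈ S := by
    intro a ha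
    rw [hc', SimpleGraph.Walk.support_map, List.mem_map] at ha
    obtain ⟨b, -, rfl⟩ := ha
    exact b.2
  clear hc'
  cases c' with
  | nil => exact hcyc.ne_nil rfl
  | cons h p =>
    have hp := ((SimpleGraph.Walk.cons_isCycle_iff p h).1 hcyc).2
    obtain ⟨L, hL, y, hy, z, hz, hyz⟩ := D.exists_separated h p hp
    have hmem : D.pos x ∈ D.walkArc (.cons h p) := by
      rw [walkArc_cons]
      exact Or.inl (D.isPolygonalArc _ _ h).left_mem
    -- A vertex of the bounding triangle outside `S` lies in the closure of the face; adding it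
    -- keeps the face connected and disjoint from the cycle.
    have hface : ∀ y ∉ D.support, ∃ a : (Sᶜ : Set V), L (D.pos a) = L y := by
      intro y hy
      obtain ⟨a, b, c, hab, hbc, hac, hfr⟩ := hD _ ⟨y, hy, rfl⟩
      obtain ⟨d, hdS, hd⟩ : ∃ d ∉ S, D.pos d ∈ frontier (connectedComponentIn D.supportᶜ y) := by
        rw [hfr]
        by_contra! hcon
        refine hS a ?_ b ?_ c ?_ hab hbc hac <;> by_contra hn <;> refine hcon _ hn ?_
        · exact Or.inl (Or.inl (D.isPolygonalArc _ _ hab).left_mem)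
        · exact Or.inl (Or.inl (D.isPolygonalArc _ _ hab).right_mem)
        · exact Or.inr (D.isPolygonalArc _ _ hac).right_mem
      refine ⟨⟨d, hdS⟩, ?_⟩
      have hpre : IsPreconnected (insert (D.pos d) (connectedComponentIn D.supportᶜ y)) :=
        isPreconnected_connectedComponentIn.subset_closure (subset_insert _ _)
          (insert_subset (frontier_subset_closure hd) subset_closure)
      refine hL.eq_of_isPreconnected hmem hpre ?_ (mem_insert _ _)
        (mem_insert_of_mem _ (mem_connectedComponentIn hy))
      rw [Set.disjoint_left]
      rintro w (rfl | hw) hwK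
      · exact D.pos_notMem_walkArc (fun h' => hdS (hsupp _ h')) hwK
      · exact connectedComponentIn_subset _ _ hw (D.walkArc_subset_support _ hwK)
    have hwalk : ∀ (a b : (Sᶜ : Set V)), (G.induce Sᶜ).Walk a b → L (D.pos a) = L (D.pos b) := by
      intro a b w
      induction w with
      | nil => rfl
      | @cons a b _ hadj _ ih =>
        rw [← ih]
        have harc := D.isPolygonalArc a b hadj
        exact hL.eq_of_isPreconnected hmem harc.isPreconnected
          (D.disjoint_arc_walkArc hadj (fun h' => a.2 (hsupp _ h')) (fun h' => b.2 (hsupp _ h')))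
          harc.left_mem harc.right_mem
    obtain ⟨a, ha⟩ := hface y hy
    obtain ⟨b, hb⟩ := hface z hz
    obtain ⟨w⟩ := hconn a b
    exact hyz (by rw [← ha, ← hb, hwalk a b w])

end PlaneDrawing

end CAIGraph

namespace CAIGraph

/-! ### Induced subgraphs of induced subgraphs -/

/-- Inducing twice is inducing on the image. -/
noncomputable def induceInduceIso {V : Type*} (G : SimpleGraph V) (s : Set V) (A : Set s) :
    (G.induce s).induce A ≃g G.induce (Subtype.val '' A) where
  toEquiv := Equiv.Set.image _ A Subtype.val_injective
  map_rel_iff' := Iff.rfl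

theorem underlying_induceDigraph {V : Type*} (D : Digraph V) (s : Set V) :
    underlying (induceDigraph D s) = (underlying D).induce s := by
  ext u v
  exact and_congr_left' Subtype.val_injective.ne_iff.symm

theorem isDiacyclicSet_image_val {V : Type*} {D : Digraph V} {s : Set V} {A : Set s}
    (h : IsDiacyclicSet (induceDigraph D s) A) : IsDiacyclicSet D (Subtype.val '' A) := by
  rintro ⟨n, c, hc, hadj⟩
  refine h ⟨n, fun i => (Equiv.Set.image _ A Subtype.val_injective).symm (c i),
    (Equiv.injective _).comp hc, fun i => ?_⟩
  have hval : ∀ x, (((Equiv.Set.image _ A Subtype.val_injective).symm x : A) : V) = x :=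
    fun x => congrArg Subtype.val ((Equiv.Set.image _ A Subtype.val_injective).apply_symm_apply x)
  simpa only [induceDigraph, hval] using hadj i

theorem isCompl_image_val {V : Type*} {s : Set V} {A J : Set ↥sᶜ} (h : IsCompl A J) :
    IsCompl (Subtype.val '' A) (Subtype.val '' J ∪ s) := by
  obtain rfl : J = Aᶜ := h.compl_eq.symm
  rw [show Subtype.val '' Aᶜ ∪ s = (Subtype.val '' A)ᶜ from ?_]
  · exact isCompl_compl
  · ext x
    by_cases hx : x ∈ s <;> simp [hx]

/-- In an oriented graph, directed cycles are cycles of the underlying graph. -/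
theorem IsForestSet.isDiacyclicSet {V : Type*} {D : Digraph V} (hD : IsOriented D) {S : Set V}
    (h : IsForestSet (underlying D) S) : IsDiacyclicSet D S := by
  rintro ⟨n, c, hc, hadj⟩
  -- Index `n` means `n + 1` vertices: `0` is a loop, `1` a 2-cycle, and from three vertices on `c`
  -- embeds a cycle graph.
  match n with
  | 0 => exact hD.1 _ (hadj 0)
  | 1 => exact hD.2 _ _ (hadj 0) (hadj 1)
  | n + 2 =>
    refine SimpleGraph.isAcyclic_iff_free_cycleGraph.1 h (n + 3) (by omega) ⟨⟨⟨c, ?_⟩, hc⟩⟩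
    intro i j hij
    refine ⟨fun h' => hij.ne (hc (Subtype.val_injective h')), ?_⟩
    rcases SimpleGraph.cycleGraph_adj.1 hij with h' | h'
    · obtain rfl : i = j + 1 := by rw [← h']; abel
      exact Or.inr (hadj j)
    · obtain rfl : j = i + 1 := by rw [← h']; abel
      exact Or.inl (hadj i)

/-- In a planar triangulation, two independent sets whose union has a connected complement induce
a forest. -/
theorem IsPlanarTriangulation.isForestSet_union {V : Type*} [Finite V] {G : SimpleGraph V}
    (hG : IsPlanarTriangulation G) {A I J : Set V} (hI : G.IsIndepSet I) (hJ : G.IsIndepSet J)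
    (hA : IsCompl A (J ∪ I)) (hconn : IsConnectedSet G A) : IsForestSet G (J ∪ I) := by
  obtain ⟨D, hD⟩ := hG
  refine D.isForestSet_of_compl_preconnected hD ?_ ?_
  · intro a ha b hb c hc hab hbc hac
    have key : ∀ {T : Set V}, G.IsIndepSet T → ∀ {x y}, G.Adj x y → x ∈ T → y ∉ T :=
      fun hT _ _ h hx hy => hT hx hy h.ne h
    -- Pigeonhole: two of the three vertices lie in the same independent set.
    rcases ha with ha | ha <;> rcases hb with hb | hb <;> rcases hc with hc | hc
    all_goals first
      | exact key hI hab ha hb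
      | exact key hI hbc hb hc
      | exact key hI hac ha hc
      | exact key hJ hab ha hb
      | exact key hJ hbc hb hc
      | exact key hJ hac ha hc
  · rw [hA.symm.compl_eq]
    exact hconn.preconnected

theorem isIndepSet_image_val {V : Type*} {G : SimpleGraph V} {s : Set V} {J : Set s}
    (h : (G.induce s).IsIndepSet J) : G.IsIndepSet (Subtype.val '' J) := by
  rintro _ ⟨a, ha, rfl⟩ _ ⟨b, hb, rfl⟩ hab
  exact h ha hb fun h' => hab (congrArg _ h')

end CAIGraph

/-! ### The undirected and the oriented statement -/

theorem mainTheorem6 {V : Type*} [Finite V] :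
    (∀ (G : SimpleGraph V) (P : Fin 3 → Set V),
      IsPlanarTriangulation G → IsEulerian G → IsTripartition G P →
      ∀ (i : Fin 3) (A J : Set ↥(P i)ᶜ), IsCAIPartition (G.induce (P i)ᶜ) A J →
        IsCompl (Subtype.val '' A) (Subtype.val '' J ∪ P i) ∧
        IsConnectedSet G (Subtype.val '' A) ∧
        IsForestSet G (Subtype.val '' A) ∧
        IsForestSet G (Subtype.val '' J ∪ P i)) ∧
    (∀ (D : Digraph V) (P : Fin 3 → Set V),
      IsOriented D → IsPlanarTriangulation (underlying D) → IsEulerianDigraph D →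
      IsTripartition (underlying D) P →
      ∀ (i : Fin 3) (A J : Set ↥(P i)ᶜ), IsCAIDipartition (induceDigraph D (P i)ᶜ) A J →
        IsCompl (Subtype.val '' A) (Subtype.val '' J ∪ P i) ∧
        IsConnectedSet (underlying D) (Subtype.val '' A) ∧
        IsDiacyclicSet D (Subtype.val '' A) ∧
        IsDiacyclicSet D (Subtype.val '' J ∪ P i) ∧
        IsForestSet (underlying D) (Subtype.val '' J ∪ P i)) := by
  refine ⟨?_, ?_⟩
  · intro G P hG _ hP i A J h
    have hcompl := isCompl_image_val h.isCompl
    have hconn : IsConnectedSet G (Subtype.val '' A) :=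
      (induceInduceIso G _ A).connected_iff.1 h.connected
    exact ⟨hcompl, hconn, (induceInduceIso G _ A).isAcyclic_iff.1 h.acyclic,
      hG.isForestSet_union (hP.indep i) (isIndepSet_image_val h.indep) hcompl hconn⟩
  · intro D P hD hG _ hP i A J h
    have hcompl := isCompl_image_val h.isCompl
    have hc := h.connected
    have hJ := h.indep
    rw [underlying_induceDigraph] at hc hJ
    have hconn : IsConnectedSet (underlying D) (Subtype.val '' A) :=
      (induceInduceIso _ _ A).connected_iff.1 hc
    -- The second set is handled in the underlying graph. The first is only free of directed cycles,
    -- which is inherited from the given partition.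
    have hforest := hG.isForestSet_union (hP.indep i) (isIndepSet_image_val hJ) hcompl hconn
    exact ⟨hcompl, hconn, isDiacyclicSet_image_val h.acyclic, hforest.isDiacyclicSet hD, hforest⟩
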